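/- Let $1\le r\le\infty$ and let $M$ be a compact Riemannian manifold without boundary, of class $C^r$ and with continuous Riemannian metric; $d$ denotes its Riemannian distance ($d=\infty$ between different connected components) and $\mathbf d=\min\{1,d\}$. For $i\in\mathbb Z$ let $M_i$ be a copy of $M$. Let $\mathrm{Diff}^r(M)$ be the set of $C^r$-diffeomorphisms of $M$ with the $C^r$-topology (uniform closeness, on compact subsets of charts, of the local representatives together with their derivatives up to order $r$, respectively up to any finite order if $r=\infty$). Let $F^r(M)$ be the set of two-sided sequences $f=(f_i)_{i\in\mathbb Z}$ of $C^r$-diffeomorphisms $f_i:M_i\to M_{i+1}$, with the strong (Whitney) topology, generated by the boxes $\prod_{i}U_i$ with all $U_i\subseteq\mathrm{Diff}^r(M)$ open; equivalently, for any metric $d^r$ on $\mathrm{Diff}^r(M)$ inducing the $C^r$-topology, it is generated by the strong basic neighbourhoods $B^r(f,\varepsilon)=\{g: d^r(f_i,g_i)<\varepsilon_i\ \forall i\in\mathbb Z\}$, $f\in F^r(M)$, $\varepsilon=(\varepsilon_i)_{i\in\mathbb Z}$ a sequence of positive numbers. For $f\in F^r(M)$, $i\in\mathbb Z$ and $n\ge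 0$ put $f_i^n=f_{i+n-1}\circ\cdots\circ f_i$ ($f_i^0$ is the identity). Let $r[n,i](\varepsilon,f)$ be the smallest cardinality of a compact set $K\subseteq M_i$ such that for each $x\in M_i$ there is $y\in K$ with $\mathbf d(f_i^j(x),f_i^j(y))<\varepsilon$ for all $0\le j<n$, and put $$H_i(f)=\lim_{\varepsilon\to0}\limsup_{n\to\infty}\frac1n\log r[n,i](\varepsilon,f).$$ Let $H_i^{(-1)}(f)$ be defined in the same way from the inverse sequence $f^{-1}=(f_i^{-1}:M_{i+1}\to M_i)_{i\in\mathbb Z}$, that is, with $f_i^n$ replaced by $f_{i-n+1}^{-1}\circ\cdots\circ f_i^{-1}$ on $M_{i+1}$. Then $H_i(f)$ and $H^{(-1)}_i(f)$ do not depend on $i$; write $H(f)$ and $H^{(-1)}(f)$ for the common values. The functions $H$ and $H^{(-1)}$, with values in the extended real numbers, are locally constant on $F^r(M)$ for the strong topology, and hence continuous. Moreover, every $f\in F^r(M)$ has a neighbourhood in the strong topology all of whose elements $g$ are positively and negatively uniformly conjugate to $f$: there are homeomorphisms $h_i$ of $M$ for $i\ge0$ (respectively for $i\le0$) such that the families $(h_i)$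 and $(h_i^{-1})$ are uniformly equicontinuous and $h_{i+1}\circ f_i=g_i\circ h_i$ for all $i\ge0$ (respectively for all $i\le-1$). -/

import Mathlib

open scoped Manifold ContDiff Topology ENNReal Bundle
open Filter Set Bundle

noncomputable section

/-! ### The `C^r` topology on the set of `C^r` diffeomorphisms of a manifold -/

section CrTopology

variable (E : Type*) [NormedAddCommGroup E] [NormedSpace ℝ E]
  (M : Type*) [TopologicalSpace M] [ChartedSpace E M] (r : ℕ∞)

/-- The set `Diff^r(M)` of `C^r` diffeomorphisms of `M`, where `M` is a manifold without boundary
modelled on the vector space `E`. -/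
abbrev CrDiffeo : Type _ := M ≃ₘ^(r : ℕ∞ω)⟮𝓘(ℝ, E), 𝓘(ℝ, E)⟯ M

variable {E M r}

/-- The subbasic neighbourhood `N^k(f; (φ, U), (ψ, V), K, ε)` of `f` in `Diff^r(M)`: all `g` that
map the compact set `K ⊆ U` into `V` and such that all the derivatives up to order `k` of the local
representatives `ψ ∘ f ∘ φ⁻¹` and `ψ ∘ g ∘ φ⁻¹` are `ε`-close on `φ(K)`. -/
def crNhd (f : CrDiffeo E M r) (φ ψ : OpenPartialHomeomorph M E) (K : Set M) (k : ℕ) (ε : ℝ) :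
    Set (CrDiffeo E M r) :=
  {g | MapsTo g K ψ.source ∧ ∀ x ∈ φ '' K, ∀ j ≤ k,
    ‖iteratedFDeriv ℝ j (ψ ∘ f ∘ φ.symm) x - iteratedFDeriv ℝ j (ψ ∘ g ∘ φ.symm) x‖ < ε}

variable (E M r)

/-- The `C^r` topology on `Diff^r(M)`, generated by the sets `N^k(f; (φ, U), (ψ, V), K, ε)`, where
`φ : U → E` and `ψ : V → E` are `C^r` charts of `M`, `K ⊆ U` is compact, `f(K) ⊆ V`, `ε > 0` and
`k ≤ r` is a (finite) order of differentiation. -/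
@[reducible] def crTopology : TopologicalSpace (CrDiffeo E M r) :=
  TopologicalSpace.generateFrom {N | ∃ (f : CrDiffeo E M r) (φ ψ : OpenPartialHomeomorph M E)
    (K : Set M) (k : ℕ) (ε : ℝ),
    φ ∈ IsManifold.maximalAtlas 𝓘(ℝ, E) (r : ℕ∞ω) M ∧
    ψ ∈ IsManifold.maximalAtlas 𝓘(ℝ, E) (r : ℕ∞ω) M ∧
    IsCompact K ∧ K ⊆ φ.source ∧ MapsTo f K ψ.source ∧ (k : ℕ∞) ≤ r ∧ 0 < ε ∧
    N = crNhd f φ ψ K k ε}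

/-- The set `F^r(M)` of two-sided sequences of `C^r` diffeomorphisms of `M`. The `i`-th map is
regarded as a map from the `i`-th copy `M_i` of `M` to the `(i+1)`-st copy. -/
def DiffeoSeq : Type _ := ℤ → CrDiffeo E M r

/-- The strong (Whitney) topology on `F^r(M)`: it is generated by the boxes `∏ U_i`, where every
`U_i` is open in `Diff^r(M)` for the `C^r` topology. See
`DiffeoSeq.strongTopology_eq_generateFrom_ball` for the description by the neighbourhoods
`{g | ∀ i, d^r (f_i, g_i) < ε_i}` attached to sequences of positive numbers `ε_i`. -/
instance DiffeoSeq.strongTopology : TopologicalSpace (DiffeoSeq E M r) :=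
  TopologicalSpace.generateFrom {B | ∃ U : ℤ → Set (CrDiffeo E M r),
    (∀ i, IsOpen[crTopology E M r] (U i)) ∧ B = {g : DiffeoSeq E M r | ∀ i, g i ∈ U i}}

variable {E M r}

/-- The strong basic neighbourhood `B^r(f, ε) = {g | ∀ i, d^r(f_i, g_i) < ε_i}` of `f` with respect
to a metric `d^r` on `Diff^r(M)`. -/
def DiffeoSeq.strongBall (dr : MetricSpace (CrDiffeo E M r)) (f : DiffeoSeq E M r) (ε : ℤ → ℝ) :
    Set (DiffeoSeq E M r) :=
  {g | ∀ i, dr.dist (f i) (g i) < ε i}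

/-- For every metric `d^r` on `Diff^r(M)` that induces the `C^r` topology, the strong topology on
`F^r(M)` is generated by the strong basic neighbourhoods `B^r(f, ε)`. -/
theorem DiffeoSeq.strongTopology_eq_generateFrom_ball (dr : MetricSpace (CrDiffeo E M r))
    (hdr : dr.toUniformSpace.toTopologicalSpace = crTopology E M r) :
    DiffeoSeq.strongTopology E M r = TopologicalSpace.generateFrom
      {B | ∃ (f : DiffeoSeq E M r) (ε : ℤ → ℝ), (∀ i, 0 < ε i) ∧ B = strongBall dr f ε} := by
  apply le_antisymm
  · refine le_generateFrom ?_
    rintro B ⟨f, ε, -, rfl⟩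
    refine TopologicalSpace.isOpen_generateFrom_of_mem
      ⟨fun i => {g | dr.dist (f i) g < ε i}, fun i => ?_, rfl⟩
    rw [← hdr]
    have h := Metric.isOpen_ball (x := f i) (ε := ε i)
    convert h using 1
    ext g
    simp [Metric.mem_ball, dist_comm]
  · refine le_generateFrom ?_
    rintro B ⟨U, hU, rfl⟩
    have h1 : ∀ f : DiffeoSeq E M r, (∀ i, f i ∈ U i) → ∀ i, ∃ ε > 0,
        {g | dr.dist (f i) g < ε} ⊆ U i := fun f hf i => by
      have h2 := hU i
      rw [← hdr] at h2
      obtain ⟨ε, hε, hs⟩ := Metric.isOpen_iff.1 h2 (f i) (hf i)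
      exact ⟨ε, hε, fun g hg => hs (Metric.mem_ball'.2 hg)⟩
    choose ε hε hεU using h1
    have h3 : {g : DiffeoSeq E M r | ∀ i, g i ∈ U i} =
        ⋃ (f : DiffeoSeq E M r) (hf : ∀ i, f i ∈ U i), strongBall dr f (ε f hf) := by
      ext g
      simp only [mem_ofPred_eq, mem_iUnion]
      refine ⟨fun hg => ⟨g, hg, fun i => ?_⟩, fun ⟨f, hf, hg⟩ i => hεU f hf i (hg i)⟩
      rw [dr.dist_self]
      exact hε g hg i
    rw [h3]
    refine @isOpen_iUnion _ _ (TopologicalSpace.generateFrom _) _ fun f =>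
      @isOpen_iUnion _ _ (TopologicalSpace.generateFrom _) _ fun hf => ?_
    exact TopologicalSpace.isOpen_generateFrom_of_mem ⟨f, ε f hf, hε f hf, rfl⟩

/-- The forward orbit maps `f_i^n = f_{i+n-1} ∘ ⋯ ∘ f_i` from `M_i` to `M_{i+n}`. -/
def DiffeoSeq.fwd (f : DiffeoSeq E M r) (i : ℤ) : ℕ → M → M
  | 0 => id
  | n + 1 => f (i + n) ∘ fwd f i n

/-- The orbit maps of the inverse sequence `f⁻¹ = (f_i⁻¹ : M_{i+1} → M_i)`, namely
`(f⁻¹)_i^n = f_{i-n+1}⁻¹ ∘ ⋯ ∘ f_i⁻¹` from `M_{i+1}` to `M_{i-n+1}`. -/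
def DiffeoSeq.bwd (f : DiffeoSeq E M r) (i : ℤ) : ℕ → M → M
  | 0 => id
  | n + 1 => (f (i - n)).symm ∘ bwd f i n

end CrTopology

/-! ### Entropy of a sequence of orbit maps -/

section Entropy

variable {M : Type*} [EMetricSpace M]

/-- The distance `min {1, d(x, y)}` of two points in the same copy of `M`. -/
def truncDist (x y : M) : ℝ := (min 1 (edist x y)).toReal

/-- `K` is an `(n, ε)`-span of `M` with respect to the orbit maps `T 0, T 1, …`. -/
def IsOrbitSpan (T : ℕ → M → M) (n : ℕ) (ε : ℝ) (K : Set M) : Prop :=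
  IsCompact K ∧ ∀ x, ∃ y ∈ K, ∀ j < n, truncDist (T j x) (T j y) < ε

/-- The smallest cardinality `r[n](ε)` of an `(n, ε)`-span. -/
def spanCard (T : ℕ → M → M) (n : ℕ) (ε : ℝ) : ℕ∞ :=
  ⨅ (K : Set M) (_ : IsOrbitSpan T n ε K), K.encard

/-- The exponential growth rate `limsup_n (1/n) log r[n](ε)`. -/
def spanGrowth (T : ℕ → M → M) (ε : ℝ) : EReal :=
  limsup (fun n : ℕ => ENNReal.log (spanCard T n ε : ℝ≥0∞) / (n : EReal)) atTop

/-- The entropy `lim_{ε → 0} limsup_n (1/n) log r[n](ε)`. The limit is written as a supremum, since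
`spanGrowth` is monotone in `ε`; see `tendsto_orbitEntropy`. -/
def orbitEntropy (T : ℕ → M → M) : EReal :=
  ⨆ (ε : ℝ) (_ : 0 < ε), spanGrowth T ε

theorem spanGrowth_antitone (T : ℕ → M → M) : Antitone (spanGrowth T) := by
  intro ε ε' h
  refine limsup_le_limsup (Eventually.of_forall fun n => ?_)
  refine EReal.div_le_div_right_of_nonneg (by positivity) (ENNReal.log_monotone ?_)
  have h1 : spanCard T n ε' ≤ spanCard T n ε := by
    refine le_iInf₂ fun K hK => iInf₂_le K ⟨hK.1, fun x => ?_⟩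
    obtain ⟨y, hy, hxy⟩ := hK.2 x
    exact ⟨y, hy, fun j hj => (hxy j hj).trans_le h⟩
  exact_mod_cast h1

theorem tendsto_orbitEntropy (T : ℕ → M → M) :
    Tendsto (spanGrowth T) (𝓝[>] 0) (𝓝 (orbitEntropy T)) := by
  have h := (spanGrowth_antitone T).tendsto_nhdsGT (0 : ℝ)
  rwa [sSup_image] at h

end Entropy

/-! ### Entropies and uniform conjugacies of sequences of diffeomorphisms -/

section Systems

variable {E : Type*} [NormedAddCommGroup E] [NormedSpace ℝ E]
  {M : Type*} [EMetricSpace M] [ChartedSpace E M] {r : ℕ∞}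

/-- The entropy `H_i(f)` computed from the component `M_i`. -/
def DiffeoSeq.entropyAt (f : DiffeoSeq E M r) (i : ℤ) : EReal := orbitEntropy (f.fwd i)

/-- The entropy `H_i(f⁻¹)` of the inverse sequence. -/
def DiffeoSeq.backwardEntropyAt (f : DiffeoSeq E M r) (i : ℤ) : EReal := orbitEntropy (f.bwd i)

/-- The entropy `H(f)` as a single number: the value at `i = 0` of `H_i(f)`, which is independent
of `i` when `M` is compact. -/
def DiffeoSeq.entropy (f : DiffeoSeq E M r) : EReal := f.entropyAt 0

/-- The backward entropy `H^{(-1)}(f) = H(f⁻¹)` as a single number. -/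
def DiffeoSeq.backwardEntropy (f : DiffeoSeq E M r) : EReal := f.backwardEntropyAt 0

/-- `f` and `g` are positively uniformly conjugate. Only the `h i` with `0 ≤ i` matter. -/
def DiffeoSeq.PosUniformConj (f g : DiffeoSeq E M r) : Prop :=
  ∃ h : ℤ → M ≃ₜ M,
    UniformEquicontinuous (fun (i : Ici (0 : ℤ)) (x : M) => h i x) ∧
    UniformEquicontinuous (fun (i : Ici (0 : ℤ)) (x : M) => (h i).symm x) ∧
    ∀ i : ℤ, 0 ≤ i → ∀ x, h (i + 1) (f i x) = g i (h i x)

/-- `f` and `g` are negatively uniformly conjugate. Only the `h i` with `i ≤ 0` matter. -/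
def DiffeoSeq.NegUniformConj (f g : DiffeoSeq E M r) : Prop :=
  ∃ h : ℤ → M ≃ₜ M,
    UniformEquicontinuous (fun (i : Iic (0 : ℤ)) (x : M) => h i x) ∧
    UniformEquicontinuous (fun (i : Iic (0 : ℤ)) (x : M) => (h i).symm x) ∧
    ∀ i : ℤ, i ≤ -1 → ∀ x, h (i + 1) (f i x) = g i (h i x)

end Systems

end

/-!
Why the theorem holds. Write `F_n` and `G_n` for the orbit maps `f_{n-1} ∘ ⋯ ∘ f_0` and
`g_{n-1} ∘ ⋯ ∘ g_0`. A conjugacy on the nonnegative half line is determined by `h_0`, through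
`h_n = G_n ∘ h_0 ∘ F_n⁻¹`, and the right choice is the infinite product `h_0 = lim_m G_m⁻¹ ∘ F_m`,
with inverse `lim_m F_m⁻¹ ∘ G_m`. Then `h_n` is the limit for `m → ∞` of
`G_n ∘ G_m⁻¹ ∘ F_m ∘ F_n⁻¹`, which is the identity for `m = n`. If the steps from `m` to `m + 1` with
`n ≤ m` move points by at most `2⁻ᵐ`, the limits exist and `h_n` tends uniformly to the identity, so
that the `h_n` and their inverses are uniformly equicontinuous
(`exists_tendstoUniformly_homeoOrbit`, `exists_uniform_conj_of_close`).

The step from `m` to `m + 1` is small if `g_m` is close to `f_m` to a degree that depends on the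
modulus of continuity of `G_n ∘ G_{m+1}⁻¹`. For this to be an admissible neighbourhood in the strong
topology, that modulus must not depend on `g`. This is where `r ≥ 1` is used: a
diffeomorphism has a `C^1` neighbourhood that is uniformly equicontinuous together with its inverses
(`exists_nhds_uniformEquicontinuous`), because in charts the maps `C^1`-close to `f` are uniformly
bi-Lipschitz (`exists_charts_eventually_biLipschitz`). The negative half line is the same statement
for the inverse sequence.

Entropy does not increase under a uniformly equicontinuous family of semiconjugacies, even with a
shift of time by one (`orbitEntropy_le_of_semiconj`). Applied to the maps of the sequence
itself, this shows that the entropy does not depend on the component; applied to the conjugacies,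
it shows that the entropies are locally constant.
-/

/-! ### Entropy and semiconjugacies -/

section EntropyComparison

variable {M : Type*} [EMetricSpace M]

theorem truncDist_lt_of_edist_lt {ε : ℝ} {x y : M} (h : edist x y < ENNReal.ofReal ε) :
    truncDist x y < ε := by
  have hε : 0 < ε := ENNReal.ofReal_pos.1 (bot_le.trans_lt h)
  rw [truncDist, ← ENNReal.toReal_ofReal hε.le]
  exact ENNReal.toReal_strict_mono ENNReal.ofReal_ne_top ((min_le_right _ _).trans_lt h)

theorem edist_lt_of_truncDist_lt {δ : ℝ≥0∞} {x y : M}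
    (h : truncDist x y < (min 1 δ).toReal) : edist x y < δ := by
  have h1 : min 1 (edist x y) < min 1 δ :=
    (ENNReal.toReal_lt_toReal (ne_top_of_le_ne_top ENNReal.one_ne_top (min_le_left _ _))
      (ne_top_of_le_ne_top ENNReal.one_ne_top (min_le_left _ _))).1 h
  rcases min_lt_iff.1 h1 with h2 | h2
  · exact absurd (h2.trans_le (min_le_left _ _)) (lt_irrefl _)
  · exact h2.trans_le (min_le_right _ _)

/-- The entourages `{truncDist < δ}` form a basis of the uniformity of `M`. -/
theorem eventually_uniformity_iff_truncDist {P : M × M → Prop} :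
    (∀ᶠ z in uniformity M, P z) ↔ ∃ δ > 0, ∀ x y : M, truncDist x y < δ → P (x, y) := by
  rw [uniformity_basis_edist.eventually_iff]
  constructor
  · rintro ⟨δ, hδ, h⟩
    refine ⟨(min 1 δ).toReal, ENNReal.toReal_pos (by simp [hδ.ne'])
      (ne_top_of_le_ne_top ENNReal.one_ne_top (min_le_left _ _)), fun x y hxy => ?_⟩
    exact h (x := (x, y)) (edist_lt_of_truncDist_lt hxy)
  · rintro ⟨δ, hδ, h⟩
    exact ⟨ENNReal.ofReal δ, ENNReal.ofReal_pos.2 hδ, fun z hz =>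
      h _ _ (truncDist_lt_of_edist_lt hz)⟩

/-- Shifting the time by one does not affect exponential growth rates: this holds because
`(n + 1) / n → 1`. -/
theorem limsup_div_succ_le (a : ℕ → EReal) :
    limsup (fun n : ℕ => a (n + 1) / (n : EReal)) atTop ≤
      limsup (fun n : ℕ => a n / (n : EReal)) atTop := by
  refine le_of_forall_gt_imp_ge_of_dense fun B hB => ?_
  obtain ⟨b, hb1, hb2⟩ := EReal.lt_iff_exists_real_btwn.1 hB
  obtain ⟨c, hc1, hc2⟩ := EReal.lt_iff_exists_real_btwn.1 hb1
  have hcb : c < b := EReal.coe_lt_coe_iff.1 hc2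
  refine le_trans ?_ hb2.le
  have h1 : ∀ᶠ n : ℕ in atTop, a (n + 1) / ((n + 1 : ℕ) : EReal) < c :=
    (tendsto_add_atTop_nat 1).eventually (eventually_lt_of_limsup_lt hc1)
  obtain ⟨N, hN⟩ := exists_nat_gt (c / (b - c))
  refine limsup_le_of_le (by isBoundedDefault) ?_
  filter_upwards [h1, eventually_ge_atTop N, eventually_gt_atTop 0] with n hn hnN hn0
  have hn1 : (0 : EReal) < ((n + 1 : ℕ) : EReal) := by exact_mod_cast n.succ_pos
  have hn2 : (0 : EReal) < (n : EReal) := by exact_mod_cast hn0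
  rw [EReal.div_le_iff_le_mul hn2 (EReal.natCast_ne_top n)]
  have h2 := (EReal.div_le_iff_le_mul hn1 (EReal.natCast_ne_top _)).1 hn.le
  refine h2.trans ?_
  have h3 : ((n + 1 : ℕ) : ℝ) * c ≤ (n : ℝ) * b := by
    have h4 : c / (b - c) < n := hN.trans_le (by exact_mod_cast hnN)
    rw [div_lt_iff₀ (sub_pos.2 hcb)] at h4
    push_cast
    linarith
  exact_mod_cast h3

/-- A surjection `p` that intertwines two sequences of orbit maps up to a uniformly equicontinuous
family `q` and a shift of time by at most one does not increase the entropy: it maps spans to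
spans. -/
theorem orbitEntropy_le_of_semiconj {S T : ℕ → M → M} {p : M → M} (hp : Continuous p)
    (hps : Function.Surjective p) {q : ℕ → M → M} (hq : UniformEquicontinuous q) {σ : ℕ → ℕ}
    (hσ : ∀ j, σ j ≤ j + 1) (h : ∀ j x, T j (p x) = q j (S (σ j) x)) :
    orbitEntropy T ≤ orbitEntropy S := by
  refine iSup₂_le fun ε hε => ?_
  have h1 : ∀ᶠ z in uniformity M, ∀ j, truncDist (q j z.1) (q j z.2) < ε :=
    hq {z | truncDist z.1 z.2 < ε}
      (eventually_uniformity_iff_truncDist.2 ⟨ε, hε, fun _ _ hxy => hxy⟩)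
  obtain ⟨δ, hδ, hδq⟩ := eventually_uniformity_iff_truncDist.1 h1
  refine le_iSup₂_of_le δ hδ ?_
  have h2 : ∀ n, spanCard T n ε ≤ spanCard S (n + 1) δ := by
    refine fun n => le_iInf₂ fun K hK => ?_
    refine (iInf₂_le (p '' K) ⟨hK.1.image hp, fun x => ?_⟩).trans (encard_image_le p K)
    obtain ⟨x, rfl⟩ := hps x
    obtain ⟨y, hy, hxy⟩ := hK.2 x
    refine ⟨p y, mem_image_of_mem p hy, fun j hj => ?_⟩
    rw [h, h]
    exact hδq _ _ (hxy _ ((hσ j).trans_lt (by omega))) j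
  refine le_trans (limsup_le_limsup (Eventually.of_forall fun n => ?_)) (limsup_div_succ_le _)
  refine EReal.div_le_div_right_of_nonneg (by positivity) (ENNReal.log_monotone ?_)
  exact_mod_cast h2 n

end EntropyComparison

/-! ### Orbits of sequences of homeomorphisms -/

/-- The orbit homeomorphisms `s_{n-1} ∘ ⋯ ∘ s_0` of a sequence `s` of homeomorphisms. -/
def homeoOrbit {X : Type*} [TopologicalSpace X] (s : ℕ → X ≃ₜ X) : ℕ → X ≃ₜ X
  | 0 => Homeomorph.refl X
  | n + 1 => (homeoOrbit s n).trans (s n)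

section HomeoOrbit

variable {X : Type*} [TopologicalSpace X]

@[simp] theorem homeoOrbit_zero (s : ℕ → X ≃ₜ X) (x : X) : homeoOrbit s 0 x = x := rfl

theorem homeoOrbit_succ (s : ℕ → X ≃ₜ X) (n : ℕ) (x : X) :
    homeoOrbit s (n + 1) x = s n (homeoOrbit s n x) := rfl

theorem homeoOrbit_succ' (s : ℕ → X ≃ₜ X) (n : ℕ) (x : X) :
    homeoOrbit s (n + 1) x = homeoOrbit (fun k => s (k + 1)) n (s 0 x) := by
  induction n with
  | zero => rfl
  | succ n ih => rw [homeoOrbit_succ, ih, homeoOrbit_succ]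

theorem homeoOrbit_succ_symm_apply (s : ℕ → X ≃ₜ X) (n : ℕ) (x : X) :
    (homeoOrbit s (n + 1)).symm (s n x) = (homeoOrbit s n).symm x := by
  rw [Homeomorph.symm_apply_eq, homeoOrbit_succ, Homeomorph.apply_symm_apply]

end HomeoOrbit

section EntropyShift

variable {M : Type*} [EMetricSpace M]

/-- Dropping the first map of a sequence does not change the entropy. -/
theorem orbitEntropy_homeoOrbit_shift [CompactSpace M] (s : ℕ → M ≃ₜ M) :
    orbitEntropy (fun n => homeoOrbit (fun k => s (k + 1)) n) =
      orbitEntropy (fun n => homeoOrbit s n) := by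
  apply le_antisymm
  · refine orbitEntropy_le_of_semiconj (p := s 0) (s 0).continuous (s 0).surjective
      (q := fun _ => id) ?_ (σ := fun j => j + 1) (fun j => le_rfl) ?_
    · exact fun U hU => by simpa using hU
    · exact fun j x => (homeoOrbit_succ' s j x).symm
  · -- At time `0` the two orbits differ by `(s 0)⁻¹`, at time `j + 1` the orbit of `s` is the
    -- shifted orbit at time `j`.
    refine orbitEntropy_le_of_semiconj (p := (s 0).symm) (s 0).symm.continuous
      (s 0).symm.surjective (q := fun j => Nat.casesOn j (s 0).symm fun _ => id) ?_
      (σ := fun j => j - 1) (fun j => by omega) ?_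
    · intro U hU
      have h0 := CompactSpace.uniformContinuous_of_continuous (s 0).symm.continuous hU
      filter_upwards [hU, h0] with z hz hz0 j
      cases j with
      | zero => exact hz0
      | succ j => exact hz
    · intro j x
      cases j with
      | zero => rfl
      | succ j => simp [homeoOrbit_succ']

end EntropyShift

/-! ### Uniform conjugacies by infinite products -/

section UniformConj

theorem tendsto_two_mul_one_div_two_pow :
    Tendsto (fun n : ℕ => (2 * (1 / 2 ^ n) : ℝ≥0∞)) atTop (𝓝 0) := by
  have := ENNReal.Tendsto.const_mul (a := 2)
    (ENNReal.tendsto_pow_atTop_nhds_zero_of_lt_one (r := 2⁻¹) (by norm_num)) (Or.inr (by simp))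
  simpa [div_eq_mul_inv, ENNReal.inv_pow] using this

theorem UniformEquicontinuous.comp_family {ι X Y Z : Type*} [UniformSpace X] [UniformSpace Y]
    [UniformSpace Z] {F : ι → Y → Z} {G : ι → X → Y} (hF : UniformEquicontinuous F)
    (hG : UniformEquicontinuous G) : UniformEquicontinuous fun i x => F i (G i x) := by
  intro U hU
  filter_upwards [hG _ (hF U hU)] with z hz i using hz i i

/-- On a compact space, a sequence of continuous maps that converges uniformly to the identity is
uniformly equicontinuous. -/
theorem uniformEquicontinuous_of_edist_le {X : Type*} [PseudoEMetricSpace X] [CompactSpace X]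
    {h : ℕ → X → X} (hc : ∀ n, Continuous (h n)) {a : ℕ → ℝ≥0∞} (ha : Tendsto a atTop (𝓝 0))
    (hd : ∀ n x, edist (h n x) x ≤ a n) : UniformEquicontinuous h := by
  intro U hU
  obtain ⟨ε, hε, hεU⟩ := uniformity_basis_edist.mem_iff.1 hU
  have hε3 : 0 < ε / 3 := ENNReal.div_pos hε.ne' (by simp)
  obtain ⟨N, hN⟩ := eventually_atTop.1 (ha.eventually_lt_const hε3)
  have h1 : ∀ᶠ z in uniformity X, ∀ n < N, (h n z.1, h n z.2) ∈ U :=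
    (eventually_all_finite (finite_lt_nat N)).2 fun n _ =>
      CompactSpace.uniformContinuous_of_continuous (hc n) hU
  filter_upwards [h1, uniformity_basis_edist.mem_of_mem hε3] with z hz hz' n
  rcases lt_or_ge n N with hn | hn
  · exact hz n hn
  · refine hεU (show edist (h n z.1) (h n z.2) < ε from ?_)
    calc edist (h n z.1) (h n z.2)
        ≤ edist (h n z.1) z.1 + edist z.1 z.2 + edist z.2 (h n z.2) := edist_triangle4 _ _ _ _
      _ < ε / 3 + ε / 3 + ε / 3 := by
          refine ENNReal.add_lt_add (ENNReal.add_lt_add ?_ hz') ?_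
          · exact (hd n _).trans_lt (hN n hn)
          · rw [edist_comm]
            exact (hd n _).trans_lt (hN n hn)
      _ = ε := ENNReal.add_thirds ε

/-- Convergence of the infinite product `lim_m G_m⁻¹ ∘ F_m`, where `F_m` and `G_m` are the orbits of
`f` and `g`. The hypothesis compares consecutive terms of the sequences
`G_n ∘ G_m⁻¹ ∘ F_m ∘ F_n⁻¹`, `m ≥ n`, which start at the identity. -/
theorem exists_tendstoUniformly_homeoOrbit {X : Type*} [EMetricSpace X] [CompactSpace X]
    {f g : ℕ → X ≃ₜ X}
    (H : ∀ m, ∀ n ≤ m, ∀ x, edist (homeoOrbit g n ((homeoOrbit g (m + 1)).symm (f m x)))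
      (homeoOrbit g n ((homeoOrbit g (m + 1)).symm (g m x))) ≤ 1 / 2 ^ m) :
    ∃ h : X → X, Continuous h ∧
      TendstoUniformly (fun m x => (homeoOrbit g m).symm (homeoOrbit f m x)) h atTop ∧
      ∀ n x, edist (homeoOrbit g n (h ((homeoOrbit f n).symm x))) x ≤ 2 * (1 / 2 ^ n) := by
  have step : ∀ n j x, edist
      (homeoOrbit g n ((homeoOrbit g (n + j)).symm (homeoOrbit f (n + j) x)))
      (homeoOrbit g n ((homeoOrbit g (n + (j + 1))).symm (homeoOrbit f (n + (j + 1)) x)))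
        ≤ 1 / 2 ^ n / 2 ^ j := by
    intro n j x
    have h1 := H (n + j) n (Nat.le_add_right n j) (homeoOrbit f (n + j) x)
    rw [homeoOrbit_succ_symm_apply, edist_comm] at h1
    rw [← add_assoc, homeoOrbit_succ f]
    refine h1.trans (le_of_eq ?_)
    rw [pow_add, div_eq_mul_inv, div_eq_mul_inv, div_eq_mul_inv,
      ENNReal.mul_inv (by simp) (by simp), mul_assoc]
  have lim : ∀ x, ∃ y, Tendsto (fun m => (homeoOrbit g m).symm (homeoOrbit f m x)) atTop (𝓝 y) := by
    intro x
    refine cauchySeq_tendsto_of_complete (cauchySeq_of_edist_le_geometric_two 1 (by simp) ?_)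
    intro j
    simpa using step 0 j x
  choose h hh using lim
  have hu : TendstoUniformly (fun m x => (homeoOrbit g m).symm (homeoOrbit f m x)) h atTop := by
    rw [EMetric.tendstoUniformly_iff]
    intro ε hε
    filter_upwards [tendsto_two_mul_one_div_two_pow.eventually_lt_const hε] with m hm x
    rw [← mul_div_assoc] at hm
    rw [edist_comm]
    refine lt_of_le_of_lt ?_ hm
    exact edist_le_of_edist_le_geometric_two_of_tendsto 1 (fun j => by simpa using step 0 j x)
      (hh x) m
  refine ⟨h, hu.continuous (Frequently.of_forall fun m =>
    (homeoOrbit g m).symm.continuous.comp (homeoOrbit f m).continuous), hu, fun n x => ?_⟩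
  obtain ⟨x, rfl⟩ := (homeoOrbit f n).surjective x
  rw [Homeomorph.symm_apply_apply]
  have h1 : Tendsto (fun j => homeoOrbit g n
      ((homeoOrbit g (n + j)).symm (homeoOrbit f (n + j) x))) atTop (𝓝 (homeoOrbit g n (h x))) :=
    ((homeoOrbit g n).continuous.tendsto _).comp
      ((hh x).comp (tendsto_atTop_mono (fun j => Nat.le_add_left j n) tendsto_id))
  have h2 := edist_le_of_edist_le_geometric_two_of_tendsto₀ (1 / 2 ^ n)
    (fun j => step n j x) h1
  rw [edist_comm]
  simpa using h2

/-- Let `f` be a sequence of homeomorphisms of a compact space and let `𝒰 i` be uniformly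
equicontinuous sets of homeomorphisms whose sets of inverses are uniformly equicontinuous, too.
Then every sequence `g` with `g i ∈ 𝒰 i` that is sufficiently close to `f` is uniformly conjugate
to `f`. The required closeness depends on `f` and on the sets `𝒰 i` only; this is the point where
the equicontinuity of the `𝒰 i` enters. -/
theorem exists_uniform_conj_of_close {X : Type*} [EMetricSpace X] [CompactSpace X]
    (f : ℕ → X ≃ₜ X) (𝒰 : ℕ → Set (X ≃ₜ X))
    (h𝒰 : ∀ i, UniformEquicontinuous fun (g : 𝒰 i) (x : X) => g.1 x)
    (h𝒰' : ∀ i, UniformEquicontinuous fun (g : 𝒰 i) (x : X) => g.1.symm x) :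
    ∃ V : ℕ → Set (X × X), (∀ i, V i ∈ uniformity X) ∧
      ∀ g : ℕ → X ≃ₜ X, (∀ i, g i ∈ 𝒰 i) → (∀ i x, (f i x, g i x) ∈ V i) →
        ∃ h : ℕ → X ≃ₜ X, UniformEquicontinuous (fun n x => h n x) ∧
          UniformEquicontinuous (fun n x => (h n).symm x) ∧
          ∀ n x, h (n + 1) (f n x) = g n (h n x) := by
  have h1 : ∀ n, UniformEquicontinuous
      fun (g : {g : ℕ → X ≃ₜ X // ∀ i, g i ∈ 𝒰 i}) (x : X) => homeoOrbit g.1 n x := by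
    intro n
    induction n with
    | zero => exact fun U hU => mem_of_superset hU fun z hz _ => hz
    | succ n ih =>
      refine UniformEquicontinuous.comp_family (F := fun g x => g.1 n x) ?_ ih
      exact (h𝒰 n).comp fun g : {g : ℕ → X ≃ₜ X // ∀ i, g i ∈ 𝒰 i} => ⟨g.1 n, g.2 n⟩
  have h2 : ∀ n, UniformEquicontinuous
      fun (g : {g : ℕ → X ≃ₜ X // ∀ i, g i ∈ 𝒰 i}) (x : X) => (homeoOrbit g.1 n).symm x := by
    intro n
    induction n with
    | zero => exact fun U hU => mem_of_superset hU fun z hz _ => hz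
    | succ n ih =>
      refine UniformEquicontinuous.comp_family (G := fun g x => (g.1 n).symm x) ih ?_
      exact (h𝒰' n).comp fun g : {g : ℕ → X ≃ₜ X // ∀ i, g i ∈ 𝒰 i} => ⟨g.1 n, g.2 n⟩
  have h3 : ∀ m, ∃ V ∈ uniformity X, ∀ z ∈ V, ∀ n ≤ m,
      (∀ g : ℕ → X ≃ₜ X, (∀ i, g i ∈ 𝒰 i) →
        edist (homeoOrbit g n ((homeoOrbit g (m + 1)).symm z.1))
          (homeoOrbit g n ((homeoOrbit g (m + 1)).symm z.2)) ≤ 1 / 2 ^ m) ∧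
      edist (homeoOrbit f n ((homeoOrbit f (m + 1)).symm z.2))
        (homeoOrbit f n ((homeoOrbit f (m + 1)).symm z.1)) ≤ 1 / 2 ^ m := by
    intro m
    have hm : (0 : ℝ≥0∞) < 1 / 2 ^ m := ENNReal.div_pos one_ne_zero (by simp)
    have hU : {z : X × X | edist z.1 z.2 < 1 / 2 ^ m} ∈ uniformity X :=
      uniformity_basis_edist.mem_of_mem hm
    have h4 : ∀ᶠ z in uniformity X, ∀ n ≤ m,
        (∀ g : ℕ → X ≃ₜ X, (∀ i, g i ∈ 𝒰 i) →
          edist (homeoOrbit g n ((homeoOrbit g (m + 1)).symm z.1))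
            (homeoOrbit g n ((homeoOrbit g (m + 1)).symm z.2)) ≤ 1 / 2 ^ m) ∧
        edist (homeoOrbit f n ((homeoOrbit f (m + 1)).symm z.2))
          (homeoOrbit f n ((homeoOrbit f (m + 1)).symm z.1)) ≤ 1 / 2 ^ m := by
      refine (eventually_all_finite (finite_le_nat m)).2 fun n _ => ?_
      have h5 := UniformEquicontinuous.comp_family (h1 n) (h2 (m + 1)) _ hU
      have h6 := CompactSpace.uniformContinuous_of_continuous
        ((homeoOrbit f n).continuous.comp (homeoOrbit f (m + 1)).symm.continuous) hU
      filter_upwards [h5, h6] with z hz hz'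
      refine ⟨fun g hg => (hz ⟨g, hg⟩).le, ?_⟩
      rw [edist_comm]
      exact le_of_lt hz'
    exact ⟨_, h4, fun z hz => hz⟩
  choose V hV hVH using h3
  refine ⟨V, hV, fun g hg hfg => ?_⟩
  obtain ⟨h, hhc, hht, hhd⟩ := exists_tendstoUniformly_homeoOrbit (f := f) (g := g)
    fun m n hn x => (hVH m _ (hfg m x) n hn).1 g hg
  obtain ⟨k, hkc, hkt, hkd⟩ := exists_tendstoUniformly_homeoOrbit (f := g) (g := f)
    fun m n hn x => (hVH m _ (hfg m x) n hn).2
  let e : X ≃ₜ X :=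
    { toFun := h
      invFun := k
      left_inv := fun x => tendsto_nhds_unique
        (hkt.tendsto_comp hkc.continuousAt (hht.tendsto_at x)) (by simp)
      right_inv := fun x => tendsto_nhds_unique
        (hht.tendsto_comp hhc.continuousAt (hkt.tendsto_at x)) (by simp)
      continuous_toFun := hhc
      continuous_invFun := hkc }
  refine ⟨fun n => ((homeoOrbit f n).symm.trans e).trans (homeoOrbit g n),
    uniformEquicontinuous_of_edist_le (fun n => Homeomorph.continuous _)
      tendsto_two_mul_one_div_two_pow fun n x => hhd n x,
    uniformEquicontinuous_of_edist_le (fun n => Homeomorph.continuous _)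
      tendsto_two_mul_one_div_two_pow fun n x => hkd n x,
    fun n x => ?_⟩
  simp only [Homeomorph.trans_apply, homeoOrbit_succ_symm_apply]
  rfl

end UniformConj

/-! ### The `C^r` topology in charts -/

theorem UniformContinuousOn.eventually_mem {X Y : Type*} [UniformSpace X] [UniformSpace Y]
    {f : X → Y} {s : Set X} (h : UniformContinuousOn f s) {V : Set (Y × Y)}
    (hV : V ∈ uniformity Y) :
    ∀ᶠ z in uniformity X, z.1 ∈ s → z.2 ∈ s → (f z.1, f z.2) ∈ V := by
  have h1 := eventually_inf_principal.1 (h hV)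
  filter_upwards [h1] with z hz h1 h2 using hz ⟨h1, h2⟩

section LocalEstimates

variable {E : Type*} [NormedAddCommGroup E] [NormedSpace ℝ E]
  {M : Type*} [EMetricSpace M] [ChartedSpace E M] {r : ℕ∞}

attribute [local instance] crTopology

theorem contDiffAt_localRepresentative (hr : 1 ≤ r) (g : CrDiffeo E M r)
    {φ ψ : OpenPartialHomeomorph M E}
    (hφ : φ ∈ IsManifold.maximalAtlas 𝓘(ℝ, E) (r : ℕ∞ω) M)
    (hψ : ψ ∈ IsManifold.maximalAtlas 𝓘(ℝ, E) (r : ℕ∞ω) M)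
    {z : E} (hz : z ∈ φ.target) (hgz : g (φ.symm z) ∈ ψ.source) :
    ContDiffAt ℝ 1 (ψ ∘ g ∘ φ.symm) z := by
  have h1 : ContMDiffAt 𝓘(ℝ, E) 𝓘(ℝ, E) (r : ℕ∞ω) φ.symm z :=
    (contMDiffOn_symm_of_mem_maximalAtlas hφ).contMDiffAt (φ.open_target.mem_nhds hz)
  have h2 : ContMDiffAt 𝓘(ℝ, E) 𝓘(ℝ, E) (r : ℕ∞ω) g (φ.symm z) := g.contMDiff.contMDiffAt
  have h3 : ContMDiffAt 𝓘(ℝ, E) 𝓘(ℝ, E) (r : ℕ∞ω) ψ (g (φ.symm z)) :=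
    (contMDiffOn_of_mem_maximalAtlas hψ).contMDiffAt (ψ.open_source.mem_nhds hgz)
  have h4 := h3.comp z (h2.comp z h1)
  exact h4.contDiffAt.of_le (by exact_mod_cast hr)

theorem crNhd_mem_nhds (f : CrDiffeo E M r) {φ ψ : OpenPartialHomeomorph M E}
    (hφ : φ ∈ IsManifold.maximalAtlas 𝓘(ℝ, E) (r : ℕ∞ω) M)
    (hψ : ψ ∈ IsManifold.maximalAtlas 𝓘(ℝ, E) (r : ℕ∞ω) M)
    {K : Set M} (hK : IsCompact K) (hKφ : K ⊆ φ.source) (hKψ : MapsTo f K ψ.source)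
    {k : ℕ} (hk : (k : ℕ∞) ≤ r) {ε : ℝ} (hε : 0 < ε) : crNhd f φ ψ K k ε ∈ 𝓝 f := by
  have h : IsOpen (crNhd f φ ψ K k ε) := TopologicalSpace.isOpen_generateFrom_of_mem
    ⟨f, φ, ψ, K, k, ε, hφ, hψ, hK, hKφ, hKψ, hk, hε, rfl⟩
  exact h.mem_nhds ⟨hKψ, fun x _ j _ => by simpa using hε⟩

variable [FiniteDimensional ℝ E] [IsManifold 𝓘(ℝ, E) (r : ℕ∞ω) M]

/-- In suitable charts around `x₀` and `f x₀`, all `g` that are `C^1`-close to `f` are uniformly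
bi-Lipschitz on a ball. The bound from below is the quantitative inverse function theorem: the local
representative of `f` is antilipschitz, because `f⁻¹` is `C^1`, and that of `g` differs from it by a
map with a small Lipschitz constant. -/
theorem exists_charts_eventually_biLipschitz (hr : 1 ≤ r) (f : CrDiffeo E M r) (x₀ : M) :
    ∃ (φ ψ : OpenPartialHomeomorph M E) (z₀ w₀ : E) (ρ ρ' C : ℝ),
      Metric.closedBall z₀ ρ ⊆ φ.target ∧ Metric.closedBall w₀ ρ' ⊆ ψ.target ∧ 0 < C ∧
      φ.symm '' Metric.closedBall z₀ ρ ∈ 𝓝 x₀ ∧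
      (∀ ε > 0, ∀ᶠ g in 𝓝 f, ∀ a ∈ Metric.closedBall z₀ ρ, g (φ.symm a) ∈ ψ.source ∧
        ψ (g (φ.symm a)) ∈ Metric.closedBall w₀ ρ' ∧
        dist (ψ (f (φ.symm a))) (ψ (g (φ.symm a))) < ε) ∧
      ∀ᶠ g in 𝓝 f, ∀ a ∈ Metric.closedBall z₀ ρ, ∀ b ∈ Metric.closedBall z₀ ρ,
        dist (ψ (g (φ.symm a))) (ψ (g (φ.symm b))) ≤ C * dist a b ∧
        dist a b ≤ C * dist (ψ (g (φ.symm a))) (ψ (g (φ.symm b))) := by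
  let φ := chartAt E x₀
  let ψ := chartAt E (f x₀)
  have hφ : φ ∈ IsManifold.maximalAtlas 𝓘(ℝ, E) (r : ℕ∞ω) M :=
    IsManifold.chart_mem_maximalAtlas x₀
  have hψ : ψ ∈ IsManifold.maximalAtlas 𝓘(ℝ, E) (r : ℕ∞ω) M :=
    IsManifold.chart_mem_maximalAtlas (f x₀)
  have hx₀ : x₀ ∈ φ.source := mem_chart_source E x₀
  have hfx₀ : f x₀ ∈ ψ.source := mem_chart_source E (f x₀)
  have hz₀ : φ x₀ ∈ φ.target := φ.map_source hx₀
  have hw₀ : ψ (f x₀) ∈ ψ.target := ψ.map_source hfx₀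
  have hinv : φ.symm (φ x₀) = x₀ := φ.left_inv hx₀
  have hcont : ContinuousAt (fun a => f (φ.symm a)) (φ x₀) :=
    f.continuous.continuousAt.comp (φ.symm.continuousAt hz₀)
  have hcd : ContDiffAt ℝ 1 (ψ ∘ f ∘ φ.symm) (φ x₀) :=
    contDiffAt_localRepresentative hr f hφ hψ hz₀ (by rwa [hinv])
  have hcd' : ContDiffAt ℝ 1 (φ ∘ f.symm ∘ ψ.symm) (ψ (f x₀)) :=
    contDiffAt_localRepresentative hr f.symm hψ hφ hw₀ (by
      rw [ψ.left_inv hfx₀]; simpa using hx₀)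
  obtain ⟨A, s, hs, hA⟩ := hcd.exists_lipschitzOnWith
  obtain ⟨B, t, ht, hB⟩ := hcd'.exists_lipschitzOnWith
  obtain ⟨ρ', hρ', hρ't⟩ := Metric.nhds_basis_closedBall.mem_iff.1 (ψ.open_target.mem_nhds hw₀)
  have hval : (ψ ∘ f ∘ φ.symm) (φ x₀) = ψ (f x₀) := by simp [hinv]
  have hev : ∀ᶠ a in 𝓝 (φ x₀), a ∈ φ.target ∧ a ∈ s ∧ f (φ.symm a) ∈ ψ.source ∧
      ψ (f (φ.symm a)) ∈ t ∧ ψ (f (φ.symm a)) ∈ Metric.closedBall (ψ (f x₀)) (ρ' / 2) := by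
    have hc := hcd.continuousAt
    rw [ContinuousAt, hval] at hc
    filter_upwards [φ.open_target.mem_nhds hz₀, hs,
      hcont (ψ.open_source.mem_nhds (by simpa only [hinv] using hfx₀)), hc ht,
      hc (Metric.closedBall_mem_nhds _ (half_pos hρ'))] with a h1 h2 h3 h4 h5
    exact ⟨h1, h2, h3, h4, h5⟩
  obtain ⟨ρ, hρ, hball⟩ := Metric.nhds_basis_closedBall.mem_iff.1 hev
  have hKc : IsCompact (φ.symm '' Metric.closedBall (φ x₀) ρ) :=
    (isCompact_closedBall _ _).image_of_continuousOn
      (φ.symm.continuousOn.mono fun a ha => (hball ha).1)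
  have hKφ : φ.symm '' Metric.closedBall (φ x₀) ρ ⊆ φ.source := by
    rintro _ ⟨a, ha, rfl⟩
    exact φ.map_target (hball ha).1
  have hKψ : MapsTo f (φ.symm '' Metric.closedBall (φ x₀) ρ) ψ.source := by
    rintro _ ⟨a, ha, rfl⟩
    exact (hball ha).2.2.1
  have himg : ∀ a ∈ Metric.closedBall (φ x₀) ρ,
      a ∈ φ '' (φ.symm '' Metric.closedBall (φ x₀) ρ) := fun a ha =>
    ⟨_, mem_image_of_mem _ ha, φ.right_inv (hball ha).1⟩
  have hnhd : ∀ (k : ℕ), (k : ℕ∞) ≤ 1 → ∀ ε > 0, ∀ᶠ g in 𝓝 f,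
      g ∈ crNhd f φ ψ (φ.symm '' Metric.closedBall (φ x₀) ρ) k ε := fun k hk ε hε =>
    crNhd_mem_nhds f hφ hψ hKc hKφ hKψ (hk.trans hr) hε
  refine ⟨φ, ψ, φ x₀, ψ (f x₀), ρ, ρ', A + 2 * B + 2, fun a ha => (hball ha).1, hρ't,
    by positivity, ?_, ?_, ?_⟩
  · have h1 := φ.symm.image_mem_nhds (x := φ x₀) hz₀ (Metric.closedBall_mem_nhds _ hρ)
    rwa [hinv] at h1
  · intro ε hε
    filter_upwards [hnhd 0 (by simp) (min ε (ρ' / 2)) (by positivity)] with g hg a ha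
    have h1 := hg.2 a (himg a ha) 0 le_rfl
    have h2 : dist (ψ (f (φ.symm a))) (ψ (g (φ.symm a))) < min ε (ρ' / 2) := by
      rw [dist_eq_norm]
      convert h1 using 1
      rw [iteratedFDeriv_zero_eq_comp, iteratedFDeriv_zero_eq_comp]
      simp only [Function.comp_apply]
      rw [← map_sub, LinearIsometryEquiv.norm_map]
    refine ⟨hg.1 (mem_image_of_mem _ ha), ?_, h2.trans_le (min_le_left _ _)⟩
    have h3 := (hball ha).2.2.2.2
    rw [Metric.mem_closedBall] at h3 ⊢
    have h4 := dist_triangle_left (ψ (g (φ.symm a))) (ψ (f x₀)) (ψ (f (φ.symm a)))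
    linarith [h2.le.trans (min_le_right _ _)]
  · -- With `η = 1 / (2 (B + 1))` the error term absorbs at most half of the lower bound.
    have hη : (0 : ℝ) < 1 / (2 * (B + 1)) := by positivity
    have hη1 : (1 : ℝ) / (2 * (B + 1)) ≤ 1 := by
      rw [div_le_one (by positivity)]
      linarith [B.2]
    filter_upwards [hnhd 1 (by simp) _ hη] with g hg a ha b hb
    have hdf : ∀ c ∈ Metric.closedBall (φ x₀) ρ, DifferentiableAt ℝ (ψ ∘ f ∘ φ.symm) c :=
      fun c hc => (contDiffAt_localRepresentative hr f hφ hψ (hball hc).1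
        (hball hc).2.2.1).differentiableAt (by simp)
    have hdg : ∀ c ∈ Metric.closedBall (φ x₀) ρ, DifferentiableAt ℝ (ψ ∘ g ∘ φ.symm) c :=
      fun c hc => (contDiffAt_localRepresentative hr g hφ hψ (hball hc).1
        (hg.1 (mem_image_of_mem _ hc))).differentiableAt (by simp)
    have hdiff := (convex_closedBall (φ x₀) ρ).norm_image_sub_le_of_norm_fderiv_le (𝕜 := ℝ)
      (f := ψ ∘ f ∘ φ.symm - ψ ∘ g ∘ φ.symm) (C := 1 / (2 * (B + 1)))
      (fun c hc => (hdf c hc).sub (hdg c hc)) (fun c hc => by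
        have h1 := hg.2 c (himg c hc) 1 le_rfl
        have h2 : ‖iteratedFDeriv ℝ 1 (ψ ∘ f ∘ φ.symm) c - iteratedFDeriv ℝ 1 (ψ ∘ g ∘ φ.symm) c‖ =
            ‖fderiv ℝ (ψ ∘ f ∘ φ.symm - ψ ∘ g ∘ φ.symm) c‖ := by
          rw [fderiv_sub (hdf c hc) (hdg c hc)]
          refine le_antisymm ?_ ?_
          · refine ContinuousMultilinearMap.opNorm_le_bound (norm_nonneg _) fun m => ?_
            simp only [_root_.sub_apply, iteratedFDeriv_one_apply,
              Finset.univ_unique, Finset.prod_singleton]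
            exact (fderiv ℝ (ψ ∘ f ∘ φ.symm) c - fderiv ℝ (ψ ∘ g ∘ φ.symm) c).le_opNorm _
          · refine ContinuousLinearMap.opNorm_le_bound _ (norm_nonneg _) fun v => ?_
            have h3 := (iteratedFDeriv ℝ 1 (ψ ∘ f ∘ φ.symm) c -
              iteratedFDeriv ℝ 1 (ψ ∘ g ∘ φ.symm) c).le_opNorm fun _ => v
            simpa [iteratedFDeriv_one_apply] using h3
        rw [← h2]
        exact h1.le) hb ha
    have hup := hA.dist_le_mul a (hball ha).2.1 b (hball hb).2.1
    have hlow := hB.dist_le_mul _ (hball ha).2.2.2.1 _ (hball hb).2.2.2.1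
    have hinv' : ∀ c ∈ Metric.closedBall (φ x₀) ρ,
        (φ ∘ f.symm ∘ ψ.symm) (ψ (f (φ.symm c))) = c := fun c hc => by
      simp [ψ.left_inv (hball hc).2.2.1, φ.right_inv (hball hc).1]
    rw [hinv' a ha, hinv' b hb] at hlow
    simp only [Function.comp_apply, Pi.sub_apply, ← dist_eq_norm] at hdiff hup
    set fa := ψ (f (φ.symm a))
    set fb := ψ (f (φ.symm b))
    set ga := ψ (g (φ.symm a))
    set gb := ψ (g (φ.symm b))
    have e1 : dist ga gb ≤ dist fa fb + 1 / (2 * (B + 1)) * dist a b := by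
      rw [dist_eq_norm] at hdiff
      have : ga - gb = (fa - fb) - ((fa - ga) - (fb - gb)) := by abel
      rw [dist_eq_norm ga, this]
      exact (norm_sub_le _ _).trans (add_le_add (dist_eq_norm fa fb).ge hdiff)
    have e2 : dist fa fb ≤ dist ga gb + 1 / (2 * (B + 1)) * dist a b := by
      rw [dist_eq_norm] at hdiff
      have : fa - fb = (ga - gb) + ((fa - ga) - (fb - gb)) := by abel
      rw [dist_eq_norm fa, this]
      exact (norm_add_le _ _).trans (add_le_add (dist_eq_norm ga gb).ge hdiff)
    have hab : 0 ≤ dist a b := dist_nonneg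
    have hgab : 0 ≤ dist ga gb := dist_nonneg
    have hAB : (0 : ℝ) ≤ A ∧ (0 : ℝ) ≤ B := ⟨A.2, B.2⟩
    constructor
    · have e3 : 1 / (2 * (B + 1) : ℝ) * dist a b ≤ 1 * dist a b :=
        mul_le_mul_of_nonneg_right hη1 hab
      have e4 : 0 ≤ (B : ℝ) * dist a b := mul_nonneg hAB.2 hab
      linarith
    · have e5 : (B : ℝ) * (1 / (2 * (B + 1)) * dist a b) ≤ 1 / 2 * dist a b := by
        rw [← mul_assoc]
        refine mul_le_mul_of_nonneg_right ?_ hab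
        rw [mul_one_div, div_le_div_iff₀ (by positivity) (by positivity)]
        linarith
      have e6 := mul_le_mul_of_nonneg_left e2 hAB.2
      have e7 : 0 ≤ (A : ℝ) * dist ga gb := mul_nonneg hAB.1 hgab
      linarith

/-- Every `x₀` has a neighbourhood on which the `C^r` topology controls uniform distances, and on
which the members of a neighbourhood of `f` are, together with their inverses, equicontinuous. -/
theorem exists_nhds_locally_equicontinuous (hr : 1 ≤ r) (f : CrDiffeo E M r) (x₀ : M) :
    ∃ P ∈ 𝓝 x₀, (∀ V ∈ uniformity M, ∀ᶠ g in 𝓝 f, ∀ x ∈ P, (f x, g x) ∈ V) ∧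
      ∃ U ∈ 𝓝 f, ∀ V ∈ uniformity M, ∀ᶠ z in uniformity M,
        ∀ g ∈ U, ∀ x ∈ P, ∀ y ∈ P,
          (z = (x, y) → (g x, g y) ∈ V) ∧ (z = (g x, g y) → (x, y) ∈ V) := by
  obtain ⟨φ, ψ, z₀, w₀, ρ, ρ', C, hφ, hψ, hC, hP, hclose, hlip⟩ :=
    exists_charts_eventually_biLipschitz hr f x₀
  have huφs : UniformContinuousOn φ.symm (Metric.closedBall z₀ ρ) :=
    (isCompact_closedBall _ _).uniformContinuousOn_of_continuous (φ.symm.continuousOn.mono hφ)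
  have huψs : UniformContinuousOn ψ.symm (Metric.closedBall w₀ ρ') :=
    (isCompact_closedBall _ _).uniformContinuousOn_of_continuous (ψ.symm.continuousOn.mono hψ)
  have huφ : UniformContinuousOn φ (φ.symm '' Metric.closedBall z₀ ρ) := by
    refine ((isCompact_closedBall _ _).image_of_continuousOn
      (φ.symm.continuousOn.mono hφ)).uniformContinuousOn_of_continuous (φ.continuousOn.mono ?_)
    rintro _ ⟨a, ha, rfl⟩
    exact φ.map_target (hφ ha)
  have huψ : UniformContinuousOn ψ (ψ.symm '' Metric.closedBall w₀ ρ') := by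
    refine ((isCompact_closedBall _ _).image_of_continuousOn
      (ψ.symm.continuousOn.mono hψ)).uniformContinuousOn_of_continuous (ψ.continuousOn.mono ?_)
    rintro _ ⟨a, ha, rfl⟩
    exact ψ.map_target (hψ ha)
  refine ⟨_, hP, fun V hV => ?_, _, hlip.and (hclose 1 one_pos), fun V hV => ?_⟩
  · obtain ⟨ε, hε, hεV⟩ := Metric.uniformity_basis_dist.eventually_iff.1 (huψs.eventually_mem hV)
    have hf := (hclose ε hε).self_of_nhds
    filter_upwards [hclose ε hε] with g hg
    rintro _ ⟨a, ha, rfl⟩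
    have h1 := hεV (x := (ψ (f (φ.symm a)), ψ (g (φ.symm a)))) (hg a ha).2.2 (hf a ha).2.1
      (hg a ha).2.1
    rwa [ψ.left_inv (hf a ha).1, ψ.left_inv (hg a ha).1] at h1
  · obtain ⟨ε, hε, hεV⟩ := Metric.uniformity_basis_dist.eventually_iff.1
      ((huψs.eventually_mem hV).and (huφs.eventually_mem hV))
    have hD : {z : E × E | dist z.1 z.2 < ε / C} ∈ uniformity E :=
      Metric.dist_mem_uniformity (div_pos hε hC)
    filter_upwards [huφ.eventually_mem hD, huψ.eventually_mem hD] with z hz1 hz2 g hg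
    rintro _ ⟨a, ha, rfl⟩ _ ⟨b, hb, rfl⟩
    obtain ⟨hga, hga', -⟩ := hg.2 a ha
    obtain ⟨hgb, hgb', -⟩ := hg.2 b hb
    obtain ⟨hl1, hl2⟩ := hg.1 a ha b hb
    constructor
    · rintro rfl
      have h1 : dist (φ (φ.symm a)) (φ (φ.symm b)) < ε / C :=
        hz1 (mem_image_of_mem _ ha) (mem_image_of_mem _ hb)
      rw [φ.right_inv (hφ ha), φ.right_inv (hφ hb), lt_div_iff₀' hC] at h1
      have h2 := (hεV (x := (ψ (g (φ.symm a)), ψ (g (φ.symm b)))) (hl1.trans_lt h1)).1 hga' hgb'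
      rwa [ψ.left_inv hga, ψ.left_inv hgb] at h2
    · rintro rfl
      have h1 : dist (ψ (g (φ.symm a))) (ψ (g (φ.symm b))) < ε / C :=
        hz2 ⟨_, hga', ψ.left_inv hga⟩ ⟨_, hgb', ψ.left_inv hgb⟩
      rw [lt_div_iff₀' hC] at h1
      exact (hεV (x := (a, b)) (hl2.trans_lt h1)).2 ha hb

variable [CompactSpace M]

/-- The `C^r` topology is finer than the topology of uniform convergence. -/
theorem eventually_forall_mem_uniformity (hr : 1 ≤ r) (f : CrDiffeo E M r) {V : Set (M × M)}
    (hV : V ∈ uniformity M) : ∀ᶠ g in 𝓝 f, ∀ x, (f x, g x) ∈ V := by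
  choose P hP hPV _ using fun x₀ => exists_nhds_locally_equicontinuous hr f x₀
  obtain ⟨t, -, ht⟩ := isCompact_univ.elim_nhds_subcover P fun x _ => hP x
  filter_upwards [(Finset.eventually_all t).2 fun x₀ _ => hPV x₀ V hV] with g hg x
  obtain ⟨x₀, hx₀, hx⟩ := mem_iUnion₂.1 (ht (mem_univ x))
  exact hg x₀ hx₀ x hx

/-- Every `C^r` diffeomorphism, `r ≥ 1`, has a neighbourhood in the `C^r` topology that is uniformly
equicontinuous and whose inverses are uniformly equicontinuous. -/
theorem exists_nhds_uniformEquicontinuous (hr : 1 ≤ r) (f : CrDiffeo E M r) :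
    ∃ U ∈ 𝓝 f, UniformEquicontinuous (fun (g : U) (x : M) => g.1 x) ∧
      UniformEquicontinuous (fun (g : U) (x : M) => g.1.symm x) := by
  choose P hP _ U hU hUV using fun x₀ => exists_nhds_locally_equicontinuous hr f x₀
  obtain ⟨t, -, ht⟩ := isCompact_univ.elim_nhds_subcover (fun x => interior (P x))
    fun x _ => interior_mem_nhds.2 (hP x)
  -- `D` is a Lebesgue entourage of the finite cover by the interiors of the sets `P x₀`.
  obtain ⟨D, hD, hDP⟩ := lebesgue_number_lemma (U := fun x₀ : t => interior (P x₀)) isCompact_univ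
    (fun x₀ => isOpen_interior) fun x hx => by
      obtain ⟨x₀, hx₀, hx'⟩ := mem_iUnion₂.1 (ht hx)
      exact mem_iUnion.2 ⟨⟨x₀, hx₀⟩, hx'⟩
  have hcommon : ∀ x y, (x, y) ∈ D → ∃ x₀ ∈ t, x ∈ P x₀ ∧ y ∈ P x₀ := fun x y hxy => by
    obtain ⟨x₀, hx₀⟩ := hDP x (mem_univ x)
    exact ⟨x₀, x₀.2, interior_subset (hx₀ (UniformSpace.mem_ball_self x hD)),
      interior_subset (hx₀ hxy)⟩
  -- If `g` is close to `f`, then `g x` and `g y` can be close only if `(x, y) ∈ D`.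
  have hfD : ∀ᶠ z in uniformity M, (f.symm z.1, f.symm z.2) ∈ D :=
    CompactSpace.uniformContinuous_of_continuous f.symm.continuous hD
  obtain ⟨Z, hZ, hZsymm, hZD⟩ := comp_comp_symm_mem_uniformity_sets hfD
  have hgD : ∀ g : CrDiffeo E M r, (∀ x, (f x, g x) ∈ Z) → ∀ x y, (g x, g y) ∈ Z → (x, y) ∈ D := by
    intro g hg x y hxy
    have h1 : (f x, f y) ∈ {z : M × M | (f.symm z.1, f.symm z.2) ∈ D} :=
      hZD (SetRel.prodMk_mem_comp (SetRel.prodMk_mem_comp (hg x) hxy) (SetRel.symm Z (hg y)))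
    simpa using h1
  refine ⟨{g | (∀ x₀ ∈ t, g ∈ U x₀) ∧ ∀ x, (f x, g x) ∈ Z},
    ((Finset.eventually_all t).2 fun x₀ _ => hU x₀).and (eventually_forall_mem_uniformity hr f hZ),
    fun V hV => ?_, fun V hV => ?_⟩
  · filter_upwards [hD, (Finset.eventually_all t).2 fun x₀ _ => hUV x₀ V hV] with z hzD hz g
    obtain ⟨x₀, hx₀, hx, hy⟩ := hcommon _ _ hzD
    exact (hz x₀ hx₀ g.1 (g.2.1 x₀ hx₀) _ hx _ hy).1 rfl
  · filter_upwards [hZ, (Finset.eventually_all t).2 fun x₀ _ => hUV x₀ V hV] with z hzZ hz g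
    obtain ⟨x₀, hx₀, hx, hy⟩ := hcommon (g.1.symm z.1) (g.1.symm z.2)
      (hgD g.1 g.2.2 _ _ (by simpa using hzZ))
    exact (hz x₀ hx₀ g.1 (g.2.1 x₀ hx₀) _ hx _ hy).2 (by simp)

end LocalEstimates

/-! ### Sequences of diffeomorphisms -/

section Systems

variable {E : Type*} [NormedAddCommGroup E] [NormedSpace ℝ E]

/-- Closeness conditions on the individual maps define neighbourhoods in the strong topology. -/
theorem DiffeoSeq.eventually_nhds {M : Type*} [TopologicalSpace M] [ChartedSpace E M] {r : ℕ∞}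
    {f : DiffeoSeq E M r} {p : ℤ → CrDiffeo E M r → Prop}
    (h : ∀ i, ∀ᶠ g in @nhds _ (crTopology E M r) (f i), p i g) :
    ∀ᶠ g in 𝓝 f, ∀ i, p i (g i) := by
  have h1 : ∀ i, ∃ U : Set (CrDiffeo E M r), (∀ g ∈ U, p i g) ∧
      IsOpen[crTopology E M r] U ∧ f i ∈ U := fun i => by
    let _ := crTopology E M r
    exact eventually_nhds_iff.1 (h i)
  choose U hUp hUo hfU using h1
  have hB : IsOpen {g : DiffeoSeq E M r | ∀ i, g i ∈ U i} :=
    TopologicalSpace.isOpen_generateFrom_of_mem ⟨U, hUo, rfl⟩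
  exact mem_of_superset (hB.mem_nhds hfU) fun g hg i => hUp i _ (hg i)

variable {M : Type*} [EMetricSpace M] [ChartedSpace E M] {r : ℕ∞}

/-- The homeomorphisms `f_i, f_{i+1}, …`. -/
noncomputable def DiffeoSeq.fwdHomeo (f : DiffeoSeq E M r) (i : ℤ) (n : ℕ) : M ≃ₜ M :=
  (f (i + n)).toHomeomorph

/-- The homeomorphisms `f_i⁻¹, f_{i-1}⁻¹, …`. -/
noncomputable def DiffeoSeq.bwdHomeo (f : DiffeoSeq E M r) (i : ℤ) (n : ℕ) : M ≃ₜ M :=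
  (f (i - n)).toHomeomorph.symm

theorem DiffeoSeq.homeoOrbit_fwdHomeo (f : DiffeoSeq E M r) (i : ℤ) (n : ℕ) :
    ⇑(homeoOrbit (f.fwdHomeo i) n) = f.fwd i n := by
  induction n with
  | zero => rfl
  | succ n ih =>
    funext x
    rw [homeoOrbit_succ, ih]
    rfl

theorem DiffeoSeq.homeoOrbit_bwdHomeo (f : DiffeoSeq E M r) (i : ℤ) (n : ℕ) :
    ⇑(homeoOrbit (f.bwdHomeo i) n) = f.bwd i n := by
  induction n with
  | zero => rfl
  | succ n ih =>
    funext x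
    rw [homeoOrbit_succ, ih]
    rfl

theorem Int.apply_eq_apply_zero_of_succ {α : Type*} {a : ℤ → α} (h : ∀ i, a (i + 1) = a i) (i : ℤ) :
    a i = a 0 := by
  induction i using Int.induction_on with
  | zero => rfl
  | succ n ih => rw [h, ih]
  | pred n ih => rw [← ih, ← h (-n - 1), sub_add_cancel]

/-- A uniform conjugacy on the nonnegative half line preserves the forward entropy. -/
theorem DiffeoSeq.PosUniformConj.entropy_eq {f g : DiffeoSeq E M r} (hfg : f.PosUniformConj g) :
    g.entropy = f.entropy := by
  obtain ⟨h, h1, h2, h3⟩ := hfg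
  have h4 : ∀ (n : ℕ) x, g.fwd 0 n (h 0 x) = h n (f.fwd 0 n x) := by
    intro n x
    induction n with
    | zero => rfl
    | succ n ih =>
      have h5 := h3 n (by positivity) (f.fwd 0 n x)
      simp only [DiffeoSeq.fwd, Function.comp_apply, ih, zero_add, ← h5]
      push_cast
      rfl
  apply le_antisymm
  · exact orbitEntropy_le_of_semiconj (h 0).continuous (h 0).surjective
      (h1.comp fun n : ℕ => ⟨n, Int.natCast_nonneg n⟩) (σ := id) (fun j => j.le_succ) h4
  · refine orbitEntropy_le_of_semiconj (h 0).symm.continuous (h 0).symm.surjective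
      (h2.comp fun n : ℕ => ⟨n, Int.natCast_nonneg n⟩) (σ := id) (fun j => j.le_succ) fun n x => ?_
    have h5 := h4 n ((h 0).symm x)
    rw [Homeomorph.apply_symm_apply] at h5
    simp [h5]

variable [CompactSpace M]

theorem DiffeoSeq.entropyAt_eq_entropy (f : DiffeoSeq E M r) (i : ℤ) :
    f.entropyAt i = f.entropy := by
  refine Int.apply_eq_apply_zero_of_succ (a := f.entropyAt) (fun i => ?_) i
  have h1 : (fun k => f.fwdHomeo i (k + 1)) = f.fwdHomeo (i + 1) := by
    funext k
    simp only [DiffeoSeq.fwdHomeo]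
    congr 2
    push_cast
    ring
  have h2 := orbitEntropy_homeoOrbit_shift (f.fwdHomeo i)
  rw [h1] at h2
  simp only [DiffeoSeq.homeoOrbit_fwdHomeo] at h2
  exact h2

theorem DiffeoSeq.backwardEntropyAt_eq_backwardEntropy (f : DiffeoSeq E M r) (i : ℤ) :
    f.backwardEntropyAt i = f.backwardEntropy := by
  refine Int.apply_eq_apply_zero_of_succ (a := f.backwardEntropyAt) (fun i => ?_) i
  have h1 : (fun k => f.bwdHomeo (i + 1) (k + 1)) = f.bwdHomeo i := by
    funext k
    simp only [DiffeoSeq.bwdHomeo]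
    congr 3
    push_cast
    ring
  have h2 := orbitEntropy_homeoOrbit_shift (f.bwdHomeo (i + 1))
  rw [h1] at h2
  simp only [DiffeoSeq.homeoOrbit_bwdHomeo] at h2
  exact h2.symm

/-- A uniform conjugacy on the nonpositive half line preserves the backward entropy, which may be
computed from the component `M_0`. -/
theorem DiffeoSeq.NegUniformConj.backwardEntropy_eq {f g : DiffeoSeq E M r}
    (hfg : f.NegUniformConj g) : g.backwardEntropy = f.backwardEntropy := by
  obtain ⟨h, h1, h2, h3⟩ := hfg
  rw [← g.backwardEntropyAt_eq_backwardEntropy (-1), ← f.backwardEntropyAt_eq_backwardEntropy (-1)]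
  have h4 : ∀ (n : ℕ) x, g.bwd (-1) n (h 0 x) = h (-n) (f.bwd (-1) n x) := by
    intro n x
    induction n with
    | zero => rfl
    | succ n ih =>
      have h5 := h3 (-1 - n) (by omega) ((f (-1 - n)).symm (f.bwd (-1) n x))
      rw [Diffeomorph.apply_symm_apply, show (-1 - n + 1 : ℤ) = -n by ring] at h5
      simp only [DiffeoSeq.bwd, Function.comp_apply, ih, h5, Diffeomorph.symm_apply_apply]
      rw [show (-(n + 1 : ℕ) : ℤ) = -1 - n by push_cast; ring]
  apply le_antisymm
  · exact orbitEntropy_le_of_semiconj (h 0).continuous (h 0).surjective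
      (h1.comp fun n : ℕ => ⟨-n, by simp⟩) (σ := id) (fun j => j.le_succ) h4
  · refine orbitEntropy_le_of_semiconj (h 0).symm.continuous (h 0).symm.surjective
      (h2.comp fun n : ℕ => ⟨-n, by simp⟩) (σ := id) (fun j => j.le_succ) fun n x => ?_
    have h5 := h4 n ((h 0).symm x)
    rw [Homeomorph.apply_symm_apply] at h5
    simp [h5]

variable [FiniteDimensional ℝ E] [IsManifold 𝓘(ℝ, E) (r : ℕ∞ω) M]

theorem DiffeoSeq.eventually_posUniformConj (hr : 1 ≤ r) (f : DiffeoSeq E M r) :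
    ∀ᶠ g in 𝓝 f, f.PosUniformConj g := by
  choose U hU hU1 hU2 using fun i => exists_nhds_uniformEquicontinuous hr (f i)
  obtain ⟨V, hV, hconj⟩ := exists_uniform_conj_of_close (f.fwdHomeo 0)
    (fun n => Diffeomorph.toHomeomorph '' U (0 + n))
    (fun n W hW => by
      filter_upwards [hU1 (0 + n) W hW] with z hz
      rintro ⟨_, g, hg, rfl⟩
      exact hz ⟨g, hg⟩)
    (fun n W hW => by
      filter_upwards [hU2 (0 + n) W hW] with z hz
      rintro ⟨_, g, hg, rfl⟩
      exact hz ⟨g, hg⟩)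
  have hclose : ∀ᶠ g in 𝓝 f, ∀ i : ℤ, g i ∈ U i ∧ ∀ x, (f i x, g i x) ∈ V i.toNat :=
    DiffeoSeq.eventually_nhds (p := fun i g => g ∈ U i ∧ ∀ x, (f i x, g x) ∈ V i.toNat) fun i =>
      Filter.Eventually.and (hU i) (eventually_forall_mem_uniformity hr (f i) (hV i.toNat))
  filter_upwards [hclose] with g hg
  obtain ⟨h, h1, h2, h3⟩ := hconj (g.fwdHomeo 0) (fun n => mem_image_of_mem _ (hg _).1)
    fun n x => by simpa [DiffeoSeq.fwdHomeo] using (hg n).2 x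
  refine ⟨fun i => h i.toNat, h1.comp _, h2.comp _, fun i hi x => ?_⟩
  lift i to ℕ using hi
  have h4 := h3 i x
  simp only [DiffeoSeq.fwdHomeo, zero_add] at h4
  exact h4

/-- This is the positive case for the inverse sequence `n ↦ f_{-1-n}⁻¹`. If `g` is uniformly close
to `f`, then `g⁻¹` is uniformly close to `f⁻¹`, because `f⁻¹` is uniformly continuous. -/
theorem DiffeoSeq.eventually_negUniformConj (hr : 1 ≤ r) (f : DiffeoSeq E M r) :
    ∀ᶠ g in 𝓝 f, f.NegUniformConj g := by
  choose U hU hU1 hU2 using fun i => exists_nhds_uniformEquicontinuous hr (f i)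
  obtain ⟨V, hV, hconj⟩ := exists_uniform_conj_of_close (f.bwdHomeo (-1))
    (fun n => (fun g : CrDiffeo E M r => g.toHomeomorph.symm) '' U (-1 - n))
    (fun n W hW => by
      filter_upwards [hU2 (-1 - n) W hW] with z hz
      rintro ⟨_, g, hg, rfl⟩
      exact hz ⟨g, hg⟩)
    (fun n W hW => by
      filter_upwards [hU1 (-1 - n) W hW] with z hz
      rintro ⟨_, g, hg, rfl⟩
      exact hz ⟨g, hg⟩)
  have hunif : ∀ i n, {z : M × M | ((f i).symm z.2, (f i).symm z.1) ∈ V n} ∈ uniformity M :=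
    fun i n => tendsto_swap_uniformity
      (CompactSpace.uniformContinuous_of_continuous (f i).symm.continuous (hV n))
  have hclose : ∀ᶠ g in 𝓝 f, ∀ i : ℤ, g i ∈ U i ∧
      ∀ x, ((f i).symm (g i x), (f i).symm (f i x)) ∈ V (-1 - i).toNat :=
    DiffeoSeq.eventually_nhds (p := fun i g => g ∈ U i ∧
      ∀ x, ((f i).symm (g x), (f i).symm (f i x)) ∈ V (-1 - i).toNat) fun i =>
        Filter.Eventually.and (hU i) (eventually_forall_mem_uniformity hr (f i) (hunif i _))
  filter_upwards [hclose] with g hg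
  obtain ⟨h, h1, h2, h3⟩ := hconj (g.bwdHomeo (-1)) (fun n => mem_image_of_mem _ (hg _).1)
    fun n x => by
      -- Closeness of `g⁻¹` to `f⁻¹` at `x` is the closeness condition at the point `g⁻¹ x`.
      have h4 := (hg (-1 - n)).2 ((g (-1 - n)).symm x)
      rw [Diffeomorph.apply_symm_apply, Diffeomorph.symm_apply_apply] at h4
      simpa [DiffeoSeq.bwdHomeo] using h4
  refine ⟨fun i => h (-i).toNat, h1.comp _, h2.comp _, fun i hi x => ?_⟩
  obtain ⟨n, rfl⟩ : ∃ n : ℕ, i = -1 - n := ⟨(-1 - i).toNat, by omega⟩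
  have h4 := h3 n (f (-1 - n) x)
  have h5 : f.bwdHomeo (-1) n (f (-1 - n) x) = x := (f (-1 - n)).symm_apply_apply x
  have h6 : ∀ y, g (-1 - n) (g.bwdHomeo (-1) n y) = y := fun y =>
    (g (-1 - n)).apply_symm_apply y
  rw [h5] at h4
  simp only [show (-(-1 - n : ℤ)).toNat = n + 1 by omega,
    show (-(-1 - n + 1 : ℤ)).toNat = n by omega, h4, h6]

end Systems

theorem theorem6 {E : Type*} [NormedAddCommGroup E] [NormedSpace ℝ E] [FiniteDimensional ℝ E]
    {M : Type*} [EMetricSpace M] [CompactSpace M] [ChartedSpace E M]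
    (r : ℕ∞) (hr : 1 ≤ r)
    [IsManifold 𝓘(ℝ, E) 1 M] [IsManifold 𝓘(ℝ, E) (r : ℕ∞ω) M]
    [RiemannianBundle (fun x : M => TangentSpace 𝓘(ℝ, E) x)]
    [IsContinuousRiemannianBundle E (fun x : M => TangentSpace 𝓘(ℝ, E) x)]
    [IsRiemannianManifold 𝓘(ℝ, E) M] :
    (∀ (f : DiffeoSeq E M r) (i : ℤ),
      f.entropyAt i = f.entropy ∧ f.backwardEntropyAt i = f.backwardEntropy) ∧
    IsLocallyConstant (fun f : DiffeoSeq E M r => f.entropy) ∧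
    IsLocallyConstant (fun f : DiffeoSeq E M r => f.backwardEntropy) ∧
    Continuous (fun f : DiffeoSeq E M r => f.entropy) ∧
    Continuous (fun f : DiffeoSeq E M r => f.backwardEntropy) ∧
    (∀ f : DiffeoSeq E M r, ∀ᶠ g in 𝓝 f, f.PosUniformConj g ∧ f.NegUniformConj g) := by
  have hconj : ∀ f : DiffeoSeq E M r, ∀ᶠ g in 𝓝 f, f.PosUniformConj g ∧ f.NegUniformConj g :=
    fun f => (f.eventually_posUniformConj hr).and (f.eventually_negUniformConj hr)
  have hpos : IsLocallyConstant (fun f : DiffeoSeq E M r => f.entropy) :=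
    (IsLocallyConstant.iff_eventually_eq _).2 fun f => (hconj f).mono fun g hg => hg.1.entropy_eq
  have hneg : IsLocallyConstant (fun f : DiffeoSeq E M r => f.backwardEntropy) :=
    (IsLocallyConstant.iff_eventually_eq _).2 fun f =>
      (hconj f).mono fun g hg => hg.2.backwardEntropy_eq
  exact ⟨fun f i => ⟨f.entropyAt_eq_entropy i, f.backwardEntropyAt_eq_backwardEntropy i⟩,
    hpos, hneg, hpos.continuous, hneg.continuous, hconj⟩
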